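/- Let $X$ be a separable infinite-dimensional complex Banach space, let $N \colon X \to X$ be a nilpotent bounded linear operator (that is, $N^k = 0$ for some $k \ge 1$), and let $\lambda \in \mathbb{C}$ with $|\lambda| = 1$. Then $\lambda I + N$ lies in the operator-norm closure of the set of mixing operators on $X$, and hence also in the operator-norm closure of the set of hypercyclic operators on $X$. Here a bounded linear operator $T$ on $X$ is *mixing* if for each pair $U, V$ of nonempty open subsets of $X$ there is $n_0$ such that $T^n(U) \cap V \neq \emptyset$ for all $n > n_0$, and *hypercyclic* if there is a vector $v \in X$ whose orbit $\{v, Tv, T^2v, \ldots\}$ is dense in $X$. -/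

import Mathlib

/-- The hypercyclic operators on `X`: the bounded linear operators `T` for which some vector `v`
has a dense orbit `{v, T v, T² v, …}`. -/
def hypercyclicOperators (X : Type*) [NormedAddCommGroup X] [NormedSpace ℂ X] :
    Set (X →L[ℂ] X) :=
  {T | ∃ v : X, Dense (Set.range fun n : ℕ => (T ^ n) v)}

/-- The mixing operators on `X`: the bounded linear operators `T` such that for each pair `U`, `V`
of nonempty open sets, `Tⁿ(U)` meets `V` for all sufficiently large `n`. -/
def mixingOperators (X : Type*) [NormedAddCommGroup X] [NormedSpace ℂ X] :
    Set (X →L[ℂ] X) :=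
  {T | ∀ U V : Set X, IsOpen U → U.Nonempty → IsOpen V → V.Nonempty →
    ∃ n₀ : ℕ, ∀ n : ℕ, n₀ < n → ((T ^ n) '' U ∩ V).Nonempty}

/-! Approximate by operators that behave like translation on polynomials. Nilpotency and
separability give an independent sequence `e` with dense span along which `N` is strictly
triangular; a small sum `L` of rank-one operators makes every superdiagonal entry nonzero. Then `S =
N + L` can be straightened to a backward shift with weights `c * (n + 1)`. Matching its vectors with
the polynomials `(X - 1)⋯(X - n)` turns `c + S` into `p ↦ c • p(X + 1)`.

Translation is mixing because `p * (1 - X/m) ^ n` is near `p`, while shifting it by `m` gives `p(X +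
m) * (-X/m) ^ n`, which is small if `n > deg p`. A mirrored term reaches the target `q`. Baire
category passes from mixing to hypercyclic. -/

open Filter Topology Polynomial

/-! ### Translation on polynomials and mixing -/

section Polynomials

variable {E : Type*} [NormedAddCommGroup E] [NormedSpace ℂ E]

/-- `Φ` need not be continuous: degrees stay bounded, so only finitely many scalar coefficients vary
with `m`. -/
theorem tendsto_map_mul_one_add_C_mul_X_pow (Φ : ℂ[X] →ₗ[ℂ] E) {a : ℕ → ℂ}
    (ha : Tendsto a atTop (𝓝 0)) (n : ℕ) (p : ℂ[X]) :
    Tendsto (fun m => Φ (p * (1 + C (a m) * X) ^ n)) atTop (𝓝 (Φ p)) := by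
  induction n generalizing p with
  | zero => simp
  | succ n ih =>
    have h := (ih p).add (ha.smul (ih (p * X)))
    rw [zero_smul, add_zero] at h
    refine h.congr fun m => ?_
    rw [← map_smul, ← map_add, smul_eq_C_mul]
    congr 1
    ring

/-- The monomial `X ^ i` of `p` contributes `s ^ (i - n) * X ^ n * (1 + X/s) ^ i`, and `i < n`. The
bounded factor `b` will absorb the powers of `c` and signs. -/
theorem tendsto_map_comp_X_add_C_mul_pow (Φ : ℂ[X] →ₗ[ℂ] E) {b s : ℕ → ℂ} {B : ℝ}
    (hb : ∀ m, ‖b m‖ ≤ B) (hs : Tendsto (fun m => (s m)⁻¹) atTop (𝓝 0))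
    (hs0 : ∀ᶠ m in atTop, s m ≠ 0) {n : ℕ} {p : ℂ[X]} (hp : p.natDegree < n) :
    Tendsto (fun m => Φ (C (b m) * p.comp (X + C (s m)) * (C (s m)⁻¹ * X) ^ n))
      atTop (𝓝 0) := by
  have key : ∀ i ∈ Finset.range n, Tendsto
      (fun m => (p.coeff i * b m * (s m)⁻¹ ^ (n - i)) • Φ (X ^ n * (1 + C (s m)⁻¹ * X) ^ i))
      atTop (𝓝 0) := by
    intro i hi
    have hi' : n - i ≠ 0 := by have := Finset.mem_range.1 hi; omega
    have h1 : Tendsto (fun m => p.coeff i * b m * (s m)⁻¹ ^ (n - i)) atTop (𝓝 0) := by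
      have h2 : Tendsto (fun m => (s m)⁻¹ ^ (n - i)) atTop (𝓝 0) := by
        simpa [hi'] using hs.pow (n - i)
      refine squeeze_zero_norm (a := fun m => ‖p.coeff i‖ * B * ‖(s m)⁻¹ ^ (n - i)‖)
        (fun m => ?_) ?_
      · rw [norm_mul, norm_mul]
        gcongr
        exact hb m
      · simpa using h2.norm.const_mul (‖p.coeff i‖ * B)
    simpa using h1.smul (tendsto_map_mul_one_add_C_mul_X_pow Φ hs i (X ^ n))
  have hsum := tendsto_finsetSum _ key
  rw [Finset.sum_const_zero] at hsum
  refine hsum.congr' ?_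
  filter_upwards [hs0] with m hm
  simp_rw [← map_smul]
  rw [← map_sum]
  congr 1
  conv_rhs => rw [p.as_sum_range' n hp]
  rw [← coe_compRingHom_apply, map_sum, Finset.mul_sum, Finset.sum_mul]
  refine Finset.sum_congr rfl fun i hi => ?_
  have hin : n = (n - i) + i := by have := Finset.mem_range.1 hi; omega
  have hX : (X : ℂ[X]) + C (s m) = C (s m) * (1 + C (s m)⁻¹ * X) := by
    rw [mul_add, ← mul_assoc, ← C_mul, mul_inv_cancel₀ hm]
    simp [add_comm]
  have hc : C (s m)⁻¹ ^ n * C (s m) ^ i = (C ((s m)⁻¹ ^ (n - i)) : ℂ[X]) := by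
    conv_lhs => rw [hin]
    rw [pow_add, mul_assoc, ← mul_pow, ← C_mul, inv_mul_cancel₀ hm, C_1, one_pow,
      mul_one, C_pow]
  rw [coe_compRingHom_apply, monomial_comp, hX, smul_eq_C_mul, C_mul, C_mul, ← hc,
    mul_pow (C (s m))]
  ring

theorem pow_apply_map_comp {T : E →L[ℂ] E} {c : ℂ} {Φ : ℂ[X] →ₗ[ℂ] E}
    (hT : ∀ p, T (Φ p) = c • Φ (p.comp (X + 1))) (m : ℕ) (p : ℂ[X]) :
    (T ^ m) (Φ p) = c ^ m • Φ (p.comp (X + C (m : ℂ))) := by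
  induction m with
  | zero => simp
  | succ m ih =>
    rw [pow_succ', mul_apply_eq_comp, ih, map_smul, hT, smul_smul, ← pow_succ,
      comp_assoc]
    congr 3
    simp
    ring

/-- An operator that acts as a unimodular multiple of the translation `p ↦ p(X + 1)` on a dense
image of the polynomials is mixing. -/
theorem mem_mixingOperators_of_polynomial {T : E →L[ℂ] E} {c : ℂ} (hc : ‖c‖ = 1)
    {Φ : ℂ[X] →ₗ[ℂ] E} (hT : ∀ p, T (Φ p) = c • Φ (p.comp (X + 1))) (hΦ : DenseRange Φ) :
    T ∈ mixingOperators E := by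
  intro U V hU hUne hV hVne
  obtain ⟨p, hp⟩ := hΦ.exists_mem_open hU hUne
  obtain ⟨q, hq⟩ := hΦ.exists_mem_open hV hVne
  obtain ⟨n, hpn, hqn⟩ : ∃ n, p.natDegree < n ∧ q.natDegree < n :=
    ⟨p.natDegree + q.natDegree + 1, by omega, by omega⟩
  have hc0 : c ≠ 0 := by rintro rfl; simp at hc
  have hinv : Tendsto (fun m : ℕ => (m : ℂ)⁻¹) atTop (𝓝 0) := tendsto_inv_atTop_nhds_zero_nat
  have hninv : Tendsto (fun m : ℕ => (-(m : ℂ))⁻¹) atTop (𝓝 0) := by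
    simpa [inv_neg] using hinv.neg
  have hne : ∀ᶠ m : ℕ in atTop, (m : ℂ) ≠ 0 := by
    filter_upwards [eventually_gt_atTop 0] with m hm
    exact_mod_cast hm.ne'
  -- Shifting by `m` exchanges the two cutoffs up to sign: `1 - X/m` becomes `-X/m`, and `-X/m`
  -- becomes `-(1 + X/m)`.
  let u : ℕ → ℂ[X] := fun m => p * (1 + C (-(m : ℂ))⁻¹ * X) ^ n +
    C ((c ^ m)⁻¹ * (-1) ^ n) * q.comp (X + C (-(m : ℂ))) * (C (-(m : ℂ))⁻¹ * X) ^ n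
  have hu : Tendsto (fun m => Φ (u m)) atTop (𝓝 (Φ p)) := by
    have h1 := tendsto_map_mul_one_add_C_mul_X_pow Φ hninv n p
    have h2 := tendsto_map_comp_X_add_C_mul_pow Φ (b := fun m => (c ^ m)⁻¹ * (-1) ^ n) (B := 1)
      (fun m => by simp [hc]) hninv (hne.mono fun m hm => neg_ne_zero.2 hm) hqn
    simpa only [map_add, add_zero, u] using h1.add h2
  have hTu : Tendsto (fun m => (T ^ m) (Φ (u m))) atTop (𝓝 (Φ q)) := by
    have h1 := tendsto_map_mul_one_add_C_mul_X_pow Φ hinv n q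
    have h2 := tendsto_map_comp_X_add_C_mul_pow Φ (b := fun m => c ^ m * (-1) ^ n) (B := 1)
      (fun m => by simp [hc]) hinv hne hpn
    have h3 := h1.add h2
    rw [add_zero] at h3
    refine h3.congr' ?_
    filter_upwards [hne] with m hm
    rw [pow_apply_map_comp hT, ← map_smul, ← map_add]
    congr 1
    have hm1 : (C (m : ℂ)⁻¹ * C (m : ℂ) : ℂ[X]) = 1 := by
      rw [← C_mul, inv_mul_cancel₀ hm, C_1]
    have hcm : (C (c ^ m) * C ((c ^ m)⁻¹) : ℂ[X]) = 1 := by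
      rw [← C_mul, mul_inv_cancel₀ (pow_ne_zero _ hc0), C_1]
    have hsign : ((-1 : ℂ[X]) ^ n) * (-1) ^ n = 1 := by rw [← mul_pow]; simp
    have hA : (1 + C (-(m : ℂ))⁻¹ * X : ℂ[X]).comp (X + C (m : ℂ)) = -1 * (C (m : ℂ)⁻¹ * X) := by
      simp only [add_comp, mul_comp, C_comp, X_comp, one_comp, inv_neg, C_neg, neg_comp]
      linear_combination -hm1
    have hB : (C (-(m : ℂ))⁻¹ * X : ℂ[X]).comp (X + C (m : ℂ)) =
        -1 * (1 + C (m : ℂ)⁻¹ * X) := by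
      simp only [mul_comp, C_comp, X_comp, inv_neg, C_neg, neg_comp]
      linear_combination -hm1
    have hD : (X + C (-(m : ℂ)) : ℂ[X]).comp (X + C (m : ℂ)) = X := by
      simp
    simp only [u]
    rw [add_comp, mul_comp, mul_comp, mul_comp, pow_comp, pow_comp, hA, hB, comp_assoc, hD,
      comp_X, smul_eq_C_mul, C_comp, C_mul, C_mul]
    simp only [mul_pow, C_pow, C_neg, C_1] at hcm ⊢
    rw [mul_add]
    linear_combination (-(q * (1 + C (m : ℂ)⁻¹ * X) ^ n)) * hsign -
      (q * (1 + C (m : ℂ)⁻¹ * X) ^ n * (-1) ^ n * (-1) ^ n) * hcm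
  obtain ⟨n₀, hn₀⟩ := eventually_atTop.1
    ((hu.eventually (hU.mem_nhds hp)).and (hTu.eventually (hV.mem_nhds hq)))
  exact ⟨n₀, fun m hm => ⟨_, ⟨_, (hn₀ m hm.le).1, rfl⟩, (hn₀ m hm.le).2⟩⟩

/-- The operator `c + S` is mixing if `|c| = 1` and `S` is a backward shift along a sequence with
dense span. -/
theorem mem_mixingOperators_of_backwardShift {S : E →L[ℂ] E} {c : ℂ} (hc : ‖c‖ = 1) {v : ℕ → E}
    (h0 : S (v 0) = 0) (hS : ∀ n, S (v (n + 1)) = (c * (n + 1)) • v n)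
    (hv : Dense (Submodule.span ℂ (Set.range v) : Set E)) :
    c • ContinuousLinearMap.id ℂ E + S ∈ mixingOperators E := by
  have hdeg : ∀ n, ((descPochhammer ℂ n).comp (X - 1)).natDegree = n := fun n => by
    rw [natDegree_comp, descPochhammer_natDegree, ← C_1, natDegree_X_sub_C, mul_one]
  have hmonic : ∀ n, ((descPochhammer ℂ n).comp (X - 1)).Monic := fun n => by
    rw [← C_1]
    exact (monic_descPochhammer ℂ n).comp_X_sub_C 1
  -- Here `P (n + 1) = (X - (n + 1)) * P n`, so translation by 1 sends `P (n + 1)` to `X * P n = P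
  -- (n + 1) + (n + 1) • P n`.
  let P : Polynomial.Sequence ℂ :=
    { elems' := fun n => (descPochhammer ℂ n).comp (X - 1)
      degree_eq' := fun n => by rw [degree_eq_natDegree (hmonic n).ne_zero, hdeg] }
  have hP : ∀ n, P n = (descPochhammer ℂ n).comp (X - 1) := fun n => rfl
  let b := P.basis fun n => by rw [hP, (hmonic n).leadingCoeff]; exact isUnit_one
  have hb : ∀ n, b n = (descPochhammer ℂ n).comp (X - 1) := fun n => by
    simp only [b, Sequence.basis_eq_self, hP]
  let Φ : ℂ[X] →ₗ[ℂ] E := b.constr ℂ v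
  have hΦb : ∀ n, Φ (b n) = v n := fun n => b.constr_basis ℂ v n
  refine mem_mixingOperators_of_polynomial hc (Φ := Φ) ?_ ?_
  · have hlin : ((c • ContinuousLinearMap.id ℂ E + S : E →L[ℂ] E) : E →ₗ[ℂ] E) ∘ₗ Φ =
        c • (Φ ∘ₗ (aeval (R := ℂ) (X + 1 : ℂ[X])).toLinearMap) := by
      refine b.ext fun n => ?_
      have haeval : aeval (X + 1 : ℂ[X]) (b n) = descPochhammer ℂ n := by
        rw [← comp_eq_aeval, hb, comp_assoc]
        simp
      simp only [LinearMap.comp_apply, LinearMap.smul_apply, AlgHom.toLinearMap_apply, haeval,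
        hΦb]
      cases n with
      | zero =>
        have : descPochhammer ℂ 0 = b 0 := by simp [hb]
        rw [this, hΦb]
        simp [h0]
      | succ n =>
        have : descPochhammer ℂ (n + 1) = b (n + 1) + ((n : ℂ) + 1) • b n := by
          rw [hb, hb, descPochhammer_succ_comp_X_sub_one, smul_eq_C_mul]
          simp
        rw [this, map_add, map_smul, hΦb, hΦb]
        simp [hS, mul_smul]
    intro p
    rw [comp_eq_aeval]
    exact LinearMap.congr_fun hlin p
  · have : Set.range Φ = (Submodule.span ℂ (Set.range v) : Set E) := by
      rw [← LinearMap.coe_range, b.constr_range]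
    rwa [DenseRange, this]

end Polynomials

/-- Vectors whose orbit meets every basic open set form a countable intersection of dense open sets.
-/
theorem mixingOperators_subset_hypercyclicOperators (E : Type*) [NormedAddCommGroup E]
    [NormedSpace ℂ E] [CompleteSpace E] [TopologicalSpace.SeparableSpace E] :
    mixingOperators E ⊆ hypercyclicOperators E := by
  intro T hT
  have := UniformSpace.secondCountable_of_separable E
  let B := TopologicalSpace.countableBasis E
  have hB := TopologicalSpace.isBasis_countableBasis E
  have hd : Dense (⋂ V ∈ B, ⋃ n : ℕ, (T ^ n) ⁻¹' V) := by
    refine dense_biInter_of_isOpen (fun V hV => isOpen_iUnion fun n =>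
      (hB.isOpen hV).preimage (T ^ n).continuous)
      (TopologicalSpace.countable_countableBasis E) fun V hV => ?_
    rw [dense_iff_inter_open]
    intro U hU hUne
    obtain ⟨n₀, hn₀⟩ := hT U V hU hUne (hB.isOpen hV)
      (TopologicalSpace.nonempty_of_mem_countableBasis hV)
    obtain ⟨_, ⟨x, hxU, rfl⟩, hxV⟩ := hn₀ (n₀ + 1) (Nat.lt_succ_self _)
    exact ⟨x, hxU, Set.mem_iUnion.2 ⟨n₀ + 1, hxV⟩⟩
  obtain ⟨v, hv⟩ := hd.nonempty
  refine ⟨v, hB.dense_iff.2 fun V hV _ => ?_⟩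
  obtain ⟨n, hn⟩ := Set.mem_iUnion.1 (Set.mem_iInter₂.1 hv V hV)
  exact ⟨_, hn, n, rfl⟩

/-! ### Linear algebra of flags -/

section Flags

variable {K V : Type*} [Field K] [AddCommGroup V] [Module K V]

theorem span_image_Iio_le_span_independent (g : ℕ → V) (n : ℕ) :
    Submodule.span K (g '' Set.Iio n) ≤ Submodule.span K
      (g '' {i | i < n ∧ g i ∉ Submodule.span K (g '' Set.Iio i)}) := by
  induction n with
  | zero => simp
  | succ n ih =>
    have ih' := ih.trans (Submodule.span_mono (R := K) (Set.image_mono (f := g)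
      (t := {i | i < n + 1 ∧ g i ∉ Submodule.span K (g '' Set.Iio i)})
      fun i hi => ⟨hi.1.trans n.lt_succ_self, hi.2⟩))
    rw [Submodule.span_le]
    rintro _ ⟨i, hi, rfl⟩
    rcases (Nat.lt_succ_iff_lt_or_eq.1 hi) with h | rfl
    · exact ih' (Submodule.subset_span ⟨i, h, rfl⟩)
    · by_cases hg : g i ∈ Submodule.span K (g '' Set.Iio i)
      · exact ih' hg
      · exact Submodule.subset_span ⟨i, ⟨hi, hg⟩, rfl⟩

/-- A sequence whose span has infinite dimension has a linearly independent subsequence with the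
same flag of spans. -/
theorem exists_subsequence_notMem_span (g : ℕ → V)
    (hg : ¬ FiniteDimensional K (Submodule.span K (Set.range g))) :
    ∃ φ : ℕ → ℕ, (∀ n, g (φ n) ∉ Submodule.span K (g '' Set.Iio (φ n))) ∧
      (∀ n, Submodule.span K (g '' Set.Iio (φ n)) =
        Submodule.span K ((g ∘ φ) '' Set.Iio n)) ∧
      Submodule.span K (Set.range (g ∘ φ)) = Submodule.span K (Set.range g) := by
  let P : ℕ → Prop := fun i => g i ∉ Submodule.span K (g '' Set.Iio i)
  have hall : Submodule.span K (Set.range g) ≤ Submodule.span K (g '' {i | P i}) := by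
    rw [Submodule.span_le]
    rintro _ ⟨i, rfl⟩
    exact Submodule.span_mono (Set.image_mono fun j hj => hj.2)
      (span_image_Iio_le_span_independent g (i + 1)
        (Submodule.subset_span ⟨i, Nat.lt_succ_self i, rfl⟩))
  have hinf : (Set.ofPred P).Infinite := by
    intro hfin
    have := FiniteDimensional.span_of_finite K (Set.Finite.image g hfin)
    exact hg (Submodule.finiteDimensional_of_le hall)
  have hmono := Nat.nth_strictMono hinf
  refine ⟨Nat.nth P, Nat.nth_mem_of_infinite hinf, fun n => le_antisymm ?_ ?_, le_antisymm ?_ ?_⟩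
  · refine (span_image_Iio_le_span_independent g _).trans (Submodule.span_mono ?_)
    rintro _ ⟨i, ⟨hi, hPi⟩, rfl⟩
    obtain ⟨j, rfl⟩ : i ∈ Set.range (Nat.nth P) := by
      rw [Nat.range_nth_of_infinite hinf]; exact hPi
    exact ⟨j, hmono.lt_iff_lt.1 hi, rfl⟩
  · refine Submodule.span_mono ?_
    rintro _ ⟨j, hj, rfl⟩
    exact ⟨Nat.nth P j, hmono hj, rfl⟩
  · exact Submodule.span_mono (Set.range_comp_subset_range _ _)
  · refine hall.trans (Submodule.span_mono ?_)
    rintro _ ⟨i, hPi, rfl⟩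
    obtain ⟨j, rfl⟩ : i ∈ Set.range (Nat.nth P) := by
      rw [Nat.range_nth_of_infinite hinf]; exact hPi
    exact ⟨j, rfl⟩

theorem span_image_Iio_succ (e : ℕ → V) (n : ℕ) :
    Submodule.span K (e '' Set.Iio (n + 1)) =
      Submodule.span K (e '' Set.Iio n) ⊔ Submodule.span K {e n} := by
  rw [← Submodule.span_union, ← Order.succ_eq_add_one, Order.Iio_succ_eq_insert, Set.image_insert_eq, Set.insert_eq,
    Set.union_comm]

theorem span_image_Iio_mono (e : ℕ → V) {m n : ℕ} (h : m ≤ n) :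
    Submodule.span K (e '' Set.Iio m) ≤ Submodule.span K (e '' Set.Iio n) :=
  Submodule.span_mono (Set.image_mono (Set.Iio_subset_Iio h))

/-- A strictly triangular map with nonzero superdiagonal is a backward shift, with any
nonzero weights, along some sequence with the same span. -/
theorem exists_backwardShift_of_triangular (S : V →ₗ[K] V) {e : ℕ → V} {a : ℕ → K}
    (ha : ∀ n, a n ≠ 0) (h0 : S (e 0) = 0)
    (hS : ∀ n, S (e (n + 1)) - a n • e n ∈ Submodule.span K (e '' Set.Iio n))
    {w : ℕ → K} (hw : ∀ n, w n ≠ 0) :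
    ∃ v : ℕ → V, S (v 0) = 0 ∧ (∀ n, S (v (n + 1)) = w n • v n) ∧
      Submodule.span K (Set.range e) ≤ Submodule.span K (Set.range v) := by
  let F : ℕ → Submodule K V := fun n => Submodule.span K (e '' Set.Iio n)
  have hF : ∀ n, F (n + 1) = F n ⊔ Submodule.span K {e n} := span_image_Iio_succ e
  have he : ∀ n, e n ∈ F (n + 1) := fun n => Submodule.subset_span ⟨n, Nat.lt_succ_self n, rfl⟩
  have hle : ∀ n, F n ≤ F (n + 1) := fun n => span_image_Iio_mono e n.le_succ
  have hsurj : ∀ n, F n ≤ (F (n + 1)).map S := by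
    intro n
    induction n with
    | zero => simp [F]
    | succ n ih =>
      have ih' : F n ≤ (F (n + 2)).map S := ih.trans (Submodule.map_mono (hle _))
      rw [hF n, sup_le_iff, Submodule.span_singleton_le_iff_mem]
      refine ⟨ih', ?_⟩
      have h1 : S (e (n + 1)) ∈ (F (n + 2)).map S := Submodule.mem_map_of_mem (he _)
      have h2 := Submodule.smul_mem _ (a n)⁻¹ (Submodule.sub_mem _ h1 (ih' (hS n)))
      rwa [sub_sub_cancel, smul_smul, inv_mul_cancel₀ (ha n), one_smul] at h2
  have hstep : ∀ n x, (∃ d : K, d ≠ 0 ∧ x - d • e n ∈ F n) →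
      ∃ y, S y = w n • x ∧ ∃ d : K, d ≠ 0 ∧ y - d • e (n + 1) ∈ F (n + 1) := by
    rintro n x ⟨d, hd, hx⟩
    -- Chosen so that the `e n` terms of `w n • x` and `S (d' • e (n + 1))` cancel; surjectivity
    -- onto `F n` corrects the rest.
    let d' := w n * d * (a n)⁻¹
    have hr : w n • x - S (d' • e (n + 1)) ∈ F n := by
      have : w n • x - S (d' • e (n + 1)) =
          w n • (x - d • e n) - d' • (S (e (n + 1)) - a n • e n) := by
        simp only [map_smul, smul_sub, smul_smul, d', inv_mul_cancel_right₀ (ha n)]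
        abel
      rw [this]
      exact Submodule.sub_mem _ (Submodule.smul_mem _ _ hx) (Submodule.smul_mem _ _ (hS n))
    obtain ⟨r, hrF, hSr⟩ := hsurj n hr
    refine ⟨d' • e (n + 1) + r, ?_, d', ?_, ?_⟩
    · rw [map_add, hSr]; abel
    · exact mul_ne_zero (mul_ne_zero (hw n) hd) (inv_ne_zero (ha n))
    · rwa [add_sub_cancel_left]
  choose! nxt hnxtS hnxt using hstep
  let v : ℕ → V := fun n => Nat.rec (e 0) nxt n
  have hv : ∀ n, ∃ d : K, d ≠ 0 ∧ v n - d • e n ∈ F n := by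
    intro n
    induction n with
    | zero => exact ⟨1, one_ne_zero, by simp [v]⟩
    | succ n ih => exact hnxt n _ ih
  refine ⟨v, h0, fun n => hnxtS n _ (hv n), ?_⟩
  have hspan : ∀ n, F n ≤ Submodule.span K (Set.range v) := by
    intro n
    induction n with
    | zero => simp [F]
    | succ n ih =>
      rw [hF n, sup_le_iff, Submodule.span_singleton_le_iff_mem]
      refine ⟨ih, ?_⟩
      obtain ⟨d, hd, hx⟩ := hv n
      have h2 := Submodule.smul_mem _ d⁻¹
        (Submodule.sub_mem _ (Submodule.subset_span (Set.mem_range_self n)) (ih hx))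
      rwa [sub_sub_cancel, smul_smul, inv_mul_cancel₀ hd, one_smul] at h2
  rw [Submodule.span_le]
  rintro _ ⟨n, rfl⟩
  exact hspan _ (he n)

end Flags

/-! ### Triangular form and small perturbations -/

section Perturbation

variable {E : Type*} [NormedAddCommGroup E] [NormedSpace ℂ E]

/-- Hahn–Banach applied to a functional on the finite-dimensional space `p ⊔ span {x}`, where
continuity is automatic. -/
theorem exists_continuousLinearMap_eq_one_of_notMem {p : Submodule ℂ E} [FiniteDimensional ℂ p]
    {x : E} (hx : x ∉ p) : ∃ f : E →L[ℂ] ℂ, f x = 1 ∧ ∀ y ∈ p, f y = 0 := by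
  obtain ⟨f, hfx, hfp⟩ := Submodule.exists_le_ker_of_notMem hx
  let q := p ⊔ Submodule.span ℂ {x}
  obtain ⟨g, hg, -⟩ := exists_extension_norm_eq q (f.domRestrict q).toContinuousLinearMap
  have hgf : ∀ y ∈ q, g y = f y := fun y hy => hg ⟨y, hy⟩
  have hxq : x ∈ q := Submodule.mem_sup_right (Submodule.mem_span_singleton_self x)
  refine ⟨(f x)⁻¹ • g, ?_, fun y hy => ?_⟩
  · simp [hgf x hxq, hfx]
  · simp [hgf y (Submodule.mem_sup_left hy), LinearMap.mem_ker.1 (hfp hy)]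

/-- A strictly triangular operator has an arbitrarily small strictly triangular perturbation all of
whose superdiagonal entries are nonzero. -/
theorem exists_small_triangular_perturbation [CompleteSpace E] (N : E →L[ℂ] E) {e : ℕ → E}
    (he : ∀ n, e n ∉ Submodule.span ℂ (e '' Set.Iio n))
    (hN : ∀ n, N (e n) ∈ Submodule.span ℂ (e '' Set.Iio n)) {ε : ℝ} (hε : 0 < ε) :
    ∃ (L : E →L[ℂ] E) (a : ℕ → ℂ), ‖L‖ ≤ ε ∧ (∀ n, a n ≠ 0) ∧ (N + L) (e 0) = 0 ∧
      ∀ n, (N + L) (e (n + 1)) - a n • e n ∈ Submodule.span ℂ (e '' Set.Iio n) := by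
  have hfin : ∀ n, FiniteDimensional ℂ (Submodule.span ℂ (e '' Set.Iio n)) := fun n =>
    FiniteDimensional.span_of_finite ℂ ((Set.finite_Iio n).image e)
  choose f hf1 hf0 using fun n => exists_continuousLinearMap_eq_one_of_notMem (he n)
  have hf0' : ∀ n m, m < n → f n (e m) = 0 := fun n m h =>
    hf0 n _ (Submodule.subset_span ⟨m, h, rfl⟩)
  have hdiag : ∀ n, ∃ b : ℂ, N (e (n + 1)) - b • e n ∈ Submodule.span ℂ (e '' Set.Iio n) := by
    intro n
    have h := hN (n + 1)
    rw [span_image_Iio_succ, Submodule.mem_sup] at h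
    obtain ⟨y, hy, z, hz, hyz⟩ := h
    obtain ⟨b, rfl⟩ := Submodule.mem_span_singleton.1 hz
    exact ⟨b, by rwa [← hyz, add_sub_cancel_right]⟩
  choose b hb using hdiag
  -- `R n` maps `e (n + 1)` to `e n` and kills all earlier vectors, so the series is a finite sum on
  -- each `e m`.
  let R : ℕ → E →L[ℂ] E := fun n => (f (n + 1)).smulRight (e n)
  let η : ℕ → ℝ := fun n => ε / 2 / 2 ^ n / (‖R n‖ + 1)
  have hη : ∀ n, 0 < η n := fun n => by positivity
  have hw : ∀ n, ∃ w : ℂ, ‖w‖ ≤ η n ∧ b n + w ≠ 0 := by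
    intro n
    by_cases h : b n = 0
    · exact ⟨η n, by simp [abs_of_pos (hη n)], by simpa [h] using (hη n).ne'⟩
    · exact ⟨0, by simpa using (hη n).le, by simpa using h⟩
  choose w hwη hw0 using hw
  have hbound : ∀ n, ‖w n • R n‖ ≤ ε / 2 / 2 ^ n := by
    intro n
    rw [norm_smul]
    calc ‖w n‖ * ‖R n‖ ≤ η n * (‖R n‖ + 1) := by
          gcongr
          · exact hwη n
          · linarith
      _ = ε / 2 / 2 ^ n := div_mul_cancel₀ _ (by positivity)
  have hsum : Summable fun n => w n • R n :=
    Summable.of_norm_bounded (summable_geometric_two' ε) hbound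
  have hRlt : ∀ n m, m ≤ n → (w n • R n) (e m) = 0 := fun n m h => by
    simp [R, hf0' (n + 1) m (by omega)]
  have happly : ∀ m, (∑' n, w n • R n) (e m) = ∑ n ∈ Finset.range m, (w n • R n) (e m) := by
    intro m
    have h1 := hsum.hasSum.mapL (ContinuousLinearMap.apply ℂ E (e m))
    refine h1.unique (hasSum_sum_of_ne_finset_zero fun n hn => ?_)
    exact hRlt n m (by simpa using hn)
  refine ⟨∑' n, w n • R n, fun n => b n + w n, ?_, hw0, ?_, fun n => ?_⟩
  · exact tsum_of_norm_bounded (hasSum_geometric_two' ε) hbound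
  · have : N (e 0) = 0 := by simpa using hN 0
    rw [add_apply, happly, this]
    simp
  · rw [add_apply, happly, Finset.sum_range_succ]
    have h1 : (w n • R n) (e (n + 1)) = w n • e n := by simp [R, hf1]
    have h2 : ∑ i ∈ Finset.range n, (w i • R i) (e (n + 1)) ∈
        Submodule.span ℂ (e '' Set.Iio n) := by
      refine Submodule.sum_mem _ fun i hi => ?_
      have : (w i • R i) (e (n + 1)) = (w i * f (i + 1) (e (n + 1))) • e i := by
        simp [R, smul_smul]
      rw [this]
      exact Submodule.smul_mem _ _
        (Submodule.subset_span ⟨i, Finset.mem_range.1 hi, rfl⟩)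
    have h3 : N (e (n + 1)) + (∑ i ∈ Finset.range n, (w i • R i) (e (n + 1)) +
        (w n • R n) (e (n + 1))) - (b n + w n) • e n =
        (N (e (n + 1)) - b n • e n) + ∑ i ∈ Finset.range n, (w i • R i) (e (n + 1)) := by
      rw [h1, add_smul]; abel
    rw [h3]
    exact Submodule.add_mem _ (hb n) h2

/-- A nilpotent operator on a separable infinite-dimensional space is strictly triangular along
some linearly independent sequence with dense span. -/
theorem exists_triangular_of_isNilpotent [TopologicalSpace.SeparableSpace E]
    (hE : ¬ FiniteDimensional ℂ E) {N : E →L[ℂ] E} (hN : IsNilpotent N) :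
    ∃ e : ℕ → E, (∀ n, e n ∉ Submodule.span ℂ (e '' Set.Iio n)) ∧
      (∀ n, N (e n) ∈ Submodule.span ℂ (e '' Set.Iio n)) ∧
      Dense (Submodule.span ℂ (Set.range e) : Set E) := by
  obtain ⟨k, hk⟩ := hN
  let y := TopologicalSpace.denseSeq E
  -- Blocks of length `k + 1` list `N ^ k y, …, N y, y` for each `y` of a dense sequence, so `N`
  -- steps back one index or gives zero.
  let g : ℕ → E := fun i => (N ^ (k - i % (k + 1))) (y (i / (k + 1)))
  have hNg : ∀ i, N (g i) ∈ Submodule.span ℂ (g '' Set.Iio i) := by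
    intro i
    have hlt := Nat.mod_lt i (Nat.add_one_pos k)
    have hNi : N (g i) = (N ^ (k - i % (k + 1) + 1)) (y (i / (k + 1))) := by
      rw [pow_succ']; rfl
    rcases Nat.eq_zero_or_pos (i % (k + 1)) with h | h
    · have : N (g i) = 0 := by
        rw [hNi, h, pow_succ', Nat.sub_zero, hk]; simp
      rw [this]
      exact Submodule.zero_mem _
    · have hi : 0 < i := Nat.pos_of_ne_zero (by rintro rfl; simp at h)
      obtain ⟨hm, hd⟩ : (i - 1) % (k + 1) = i % (k + 1) - 1 ∧ (i - 1) / (k + 1) = i / (k + 1) := by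
        have h1 : i - 1 = (i % (k + 1) - 1) + (k + 1) * (i / (k + 1)) := by
          have := Nat.mod_add_div i (k + 1)
          omega
        constructor
        · rw [h1, Nat.add_mul_mod_self_left, Nat.mod_eq_of_lt (by omega)]
        · rw [h1, Nat.add_mul_div_left _ _ k.succ_pos, Nat.div_eq_of_lt (by omega), zero_add]
      have : N (g i) = g (i - 1) := by
        rw [hNi]
        simp only [g, hm, hd]
        congr 2
        omega
      rw [this]
      exact Submodule.subset_span ⟨i - 1, Nat.sub_lt hi one_pos, rfl⟩
  have hy : ∀ j, y j ∈ Set.range g := fun j => by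
    refine ⟨k + (k + 1) * j, ?_⟩
    simp only [g, Nat.add_mul_mod_self_left, Nat.add_mul_div_left _ _ k.succ_pos,
      Nat.mod_eq_of_lt k.lt_succ_self, Nat.div_eq_of_lt k.lt_succ_self]
    simp
  have hdense : Dense (Submodule.span ℂ (Set.range g) : Set E) :=
    (TopologicalSpace.denseRange_denseSeq E).mono (by
      rintro _ ⟨j, rfl⟩
      exact Submodule.subset_span (hy j))
  have hinf : ¬ FiniteDimensional ℂ (Submodule.span ℂ (Set.range g)) := by
    intro h
    -- A finite-dimensional span would be closed as well as dense, hence all of `E`.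
    have hclosed := (Submodule.span ℂ (Set.range g)).closed_of_finiteDimensional
    have htop : Submodule.span ℂ (Set.range g) = ⊤ := by
      rw [← SetLike.coe_set_eq, ← hclosed.closure_eq, hdense.closure_eq, Submodule.top_coe]
    rw [htop] at h
    exact hE (LinearEquiv.finiteDimensional (Submodule.topEquiv (R := ℂ) (M := E)))
  obtain ⟨φ, h1, h2, h3⟩ := exists_subsequence_notMem_span g hinf
  refine ⟨g ∘ φ, fun n => ?_, fun n => ?_, by rwa [h3]⟩
  · rw [← h2]; exact h1 n
  · rw [← h2]; exact hNg _

end Perturbation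

theorem corollary3p2 {X : Type*} [NormedAddCommGroup X] [NormedSpace ℂ X] [CompleteSpace X]
    [TopologicalSpace.SeparableSpace X] (hX : ¬ FiniteDimensional ℂ X)
    (N : X →L[ℂ] X) (hN : IsNilpotent N) (c : ℂ) (hc : ‖c‖ = 1) :
    c • ContinuousLinearMap.id ℂ X + N ∈ closure (mixingOperators X) ∧
      c • ContinuousLinearMap.id ℂ X + N ∈ closure (hypercyclicOperators X) := by
  have hc0 : c ≠ 0 := by rintro rfl; simp at hc
  suffices h : c • ContinuousLinearMap.id ℂ X + N ∈ closure (mixingOperators X) from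
    ⟨h, closure_mono (mixingOperators_subset_hypercyclicOperators X) h⟩
  obtain ⟨e, he, hNe, hdense⟩ := exists_triangular_of_isNilpotent hX hN
  refine Metric.mem_closure_iff.2 fun ε hε => ?_
  obtain ⟨L, a, hL, ha, h0, hS⟩ := exists_small_triangular_perturbation N he hNe (half_pos hε)
  obtain ⟨v, hv0, hv, hspan⟩ := exists_backwardShift_of_triangular
    ((N + L : X →L[ℂ] X) : X →ₗ[ℂ] X) ha h0 hS (w := fun n => c * (n + 1))
    fun n => mul_ne_zero hc0 n.cast_add_one_ne_zero
  refine ⟨c • ContinuousLinearMap.id ℂ X + (N + L),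
    mem_mixingOperators_of_backwardShift hc hv0 hv (hdense.mono hspan), ?_⟩
  rw [dist_eq_norm, ← add_assoc, sub_add_cancel_left, norm_neg]
  linarith
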